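/- Let $G^*$ be a directed acyclic graph (DAG) on a finite vertex set $V$. Two DAGs on the same vertex set are Markov equivalent if they have the same d-separations; let $\mathrm{MEC}(G^*)$ be the set of DAGs on $V$ that are Markov equivalent to $G^*$. For $x\in V$ let $G^{(x)}$ be the interventional graph of a singleton intervention on $x$: a new vertex $W_x$ with the single edge $W_x\to x$ is added to $G$ and, if the intervention is hard, all edges of $G$ pointing to $x$ are removed (if it is soft, they are kept). For each $x \in V$ it is fixed whether the intervention on $x$ is hard or soft. For $\mathcal I\subseteq V$ and $G\in\mathrm{MEC}(G^*)$ let $\mathcal I\text{-}\mathrm{MEC}(G)$ be the set of all $H\in\mathrm{MEC}(G)$ such that $H^{(x)}$ is Markov equivalent to $G^{(x)}$ for every $x\in\mathcal I$. The essential graph of a set of graphs on $V$ is the graph on $V$ whose edge set is the union of theirs; an edge $(a,b)$ of it is directed if $(b,a)$ is not an edge of it. Let $R(\mathcal I,G)$ be the set of edges that are directed in the essential graph of $\mathcal I\text{-}\mathrm{MEC}(G)$ but not directed in the essential graph of $\mathrm{MEC}(G^*)$, let $D(\mathcal I,G)=|R(\mathcal I,G)|$, and let $$\mathcal D(\mathcal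 I)=\frac{1}{|\mathrm{MEC}(G^*)|}\sum_{G\in\mathrm{MEC}(G^*)}D(\mathcal I,G)$$ be the average gain. Then $\mathcal D$ is submodular: for all $\mathcal I_1\subseteq\mathcal I_2\subseteq V$ and all $x\in V\setminus\mathcal I_2$, $$\mathcal D(\mathcal I_1\cup\{x\})-\mathcal D(\mathcal I_1)\ \ge\ \mathcal D(\mathcal I_2\cup\{x\})-\mathcal D(\mathcal I_2).$$ -/

import Mathlib

namespace CausalDesign

/-- A directed graph is acyclic: no vertex can be reached from itself by a nonempty chain of
edges.  In particular there are no loops and no pair of opposite edges. -/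
def IsDAG {V : Type*} (G : Digraph V) : Prop :=
  ∀ v : V, ¬ Relation.TransGen G.Adj v v

/-- `w` is a descendant of `v`; every vertex is a descendant of itself. -/
def IsDescendant {V : Type*} (G : Digraph V) (v w : V) : Prop :=
  Relation.ReflTransGen G.Adj v w

/-- A walk of the skeleton of `G` is blocked by `S`: three consecutive vertices `a, c, b` on it
form either a chain or a fork whose middle vertex `c` is in `S`, or a collider `a → c ← b` such
that no descendant of `c` (in particular not `c` itself) is in `S`. -/
def IsBlocked {V : Type*} (G : Digraph V) (S : Set V) {i j : V}
    (p : G.toSimpleGraphInclusive.Walk i j) : Prop :=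
  ∃ a c b : V, [a, c, b] <:+: p.support ∧
    ((((G.Adj a c ∧ G.Adj c b) ∨ (G.Adj c a ∧ G.Adj b c) ∨ (G.Adj c a ∧ G.Adj c b)) ∧ c ∈ S) ∨
      ((G.Adj a c ∧ G.Adj b c) ∧ ∀ d : V, IsDescendant G c d → d ∉ S))

/-- `S` d-separates `i` from `j`: it blocks every quasi-path (path in the skeleton) from `i`
to `j`. -/
def DSep {V : Type*} (G : Digraph V) (i j : V) (S : Set V) : Prop :=
  ∀ p : G.toSimpleGraphInclusive.Walk i j, p.IsPath → IsBlocked G S p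

/-- The set of all d-separations of `G`, as triples `(i, j, S)` with `i`, `j` distinct vertices
and `S` a set of further vertices. -/
def dSeparations {V : Type*} (G : Digraph V) : Set (V × V × Set V) :=
  {t | t.1 ≠ t.2.1 ∧ t.1 ∉ t.2.2 ∧ t.2.1 ∉ t.2.2 ∧ DSep G t.1 t.2.1 t.2.2}

/-- Markov equivalence: the same d-separations. -/
def MarkovEquiv {V : Type*} (G H : Digraph V) : Prop :=
  dSeparations G = dSeparations H

/-- The Markov equivalence class of `G`. -/
def mec {V : Type*} (G : Digraph V) : Set (Digraph V) :=
  {H | IsDAG H ∧ MarkovEquiv H G}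

/-- The two types of intervention. -/
inductive InterventionKind where
  | hard : InterventionKind
  | soft : InterventionKind

/-- The interventional graph of a singleton intervention on `x`.  Its vertices are those of `G`
(as `some a`) and the intervention variable `none`, which is made a parent of `x` and has no
other edges.  A hard intervention also removes all edges of `G` that point to `x`. -/
def interventionalGraph {V : Type*} (k : InterventionKind) (G : Digraph V) (x : V) :
    Digraph (Option V) where
  Adj u w :=
    match u, w with
    | some a, some b => G.Adj a b ∧ (k = InterventionKind.hard → b ≠ x)
    | none, some b => b = x
    | _, none => False

/-- The interventional Markov equivalence class of `G` for an experiment consisting of the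
passive observation and one singleton intervention on each `x ∈ I`, of kind `kind x`. -/
def interventionalMEC {V : Type*} (kind : V → InterventionKind) (I : Finset V)
    (G : Digraph V) : Set (Digraph V) :=
  {H | H ∈ mec G ∧ ∀ x ∈ I,
    MarkovEquiv (interventionalGraph (kind x) H x) (interventionalGraph (kind x) G x)}

/-- The essential graph of a class of directed graphs: the union of their edges. -/
def essentialGraph {V : Type*} (C : Set (Digraph V)) : Digraph V where
  Adj a b := ∃ H ∈ C, H.Adj a b

/-- The directed edges of a graph: the edges `(a, b)` for which `(b, a)` is not an edge. -/
def directedEdges {V : Type*} (G : Digraph V) : Set (V × V) :=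
  {e | G.Adj e.1 e.2 ∧ ¬ G.Adj e.2 e.1}

/-- The edges `R(I, G)` that are directed in the interventional essential graph of `G` but not
directed in the observational essential graph of `Gstar`. -/
def orientedEdges {V : Type*} (Gstar : Digraph V) (kind : V → InterventionKind) (I : Finset V)
    (G : Digraph V) : Set (V × V) :=
  directedEdges (essentialGraph (interventionalMEC kind I G)) \
    directedEdges (essentialGraph (mec Gstar))

/-- The gain `D(I, G)`: the number of edges oriented by the experiment if the ground truth
is `G`. -/
noncomputable def gain {V : Type*} (Gstar : Digraph V) (kind : V → InterventionKind)
    (I : Finset V) (G : Digraph V) : ℕ :=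
  (orientedEdges Gstar kind I G).ncard

/-- The average gain: the mean of `D(I, G)` over the Markov equivalence class of `Gstar`. -/
noncomputable def averageGain {V : Type*} [Fintype V] [DecidableEq V] (Gstar : Digraph V)
    (kind : V → InterventionKind) (I : Finset V) : ℝ :=
  (1 / ((mec Gstar).ncard : ℝ)) *
    ∑ G ∈ (Set.toFinite (mec Gstar)).toFinset, (gain Gstar kind I G : ℝ)

/-- Submodularity of a set function. -/
def IsSubmodular {V : Type*} [DecidableEq V] (f : Finset V → ℝ) : Prop :=
  ∀ I₁ I₂ : Finset V, I₁ ⊆ I₂ → ∀ x : V, x ∉ I₂ →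
    f (insert x I₁) - f I₁ ≥ f (insert x I₂) - f I₂

end CausalDesign

namespace CausalDesign

variable {V : Type*}

/-! For each fixed `G` the gain is a coverage function: the edges oriented by `I` are the union of
those oriented by its single interventions (`orientedEdges_eq_biUnion`). Coverage functions are
submodular, and averaging preserves this. The hard inclusion is that an edge oriented by `I` is
already oriented by some `x ∈ I`. By the Verma–Pearl criterion (`markovEquiv_iff_sameStructure`),
Markov equivalence means same skeleton and same v-structures; within a class, an intervention on
`x`, hard or soft, reveals exactly the parents of `x` (`markovEquiv_interventionalGraph_iff`). Let
`Forced G {x}` be the edges derived from this by orientation rules. If `a → b` is forced and the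
edge between `b` and `c` is left free, then `a → c` is forced (`Forced.of_free`). This closure
property passes to the union over `x ∈ I`, since an edge free for the union is free for each `x`.
Whenever a set of edges of `G` has this property and contains the v-structures, the remaining edges
form a chordal graph, and any one of them can be reversed within the class (`exists_reversal`). So
an edge forced by no single `x` is not oriented by `I`. -/

/-- Two distinct vertices joined by an edge in one of the two directions. -/
def Linked (G : Digraph V) (a b : V) : Prop := G.Adj a b ∨ G.Adj b a

lemma Linked.symm {G : Digraph V} {a b : V} (h : Linked G a b) : Linked G b a := Or.symm h

lemma IsDAG.irrefl {G : Digraph V} (hG : IsDAG G) (a : V) : ¬ G.Adj a a :=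
  fun h => hG a (.single h)

lemma IsDAG.asymm {G : Digraph V} (hG : IsDAG G) {a b : V} (h : G.Adj a b) : ¬ G.Adj b a :=
  fun h' => hG a (.tail (.single h) h')

lemma IsDAG.no_triangle {G : Digraph V} (hG : IsDAG G) {a b c : V} (h : G.Adj a b)
    (h' : G.Adj b c) : ¬ G.Adj c a :=
  fun h'' => hG a (.tail (.tail (.single h) h') h'')

lemma Linked.ne {G : Digraph V} (hG : IsDAG G) {a b : V} (h : Linked G a b) : a ≠ b := by
  rintro rfl
  exact h.elim (hG.irrefl _) (hG.irrefl _)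

lemma linked_of_skeleton_adj {G : Digraph V} {a b : V} (h : G.toSimpleGraphInclusive.Adj a b) :
    Linked G a b := h.2

lemma skeleton_adj {G : Digraph V} (hG : IsDAG G) {a b : V} (h : Linked G a b) :
    G.toSimpleGraphInclusive.Adj a b := ⟨h.ne hG, h⟩

/-! ### d-connection as reachability by the Bayes ball -/

/-- Reachability by the Bayes ball: `Reach G S i v b` says that some walk from `i` to `v`
has all its inner colliders in `S` and all other vertices before `v` outside `S`; the flag `b`
tells whether its last edge points to `v`. -/
inductive Reach (G : Digraph V) (S : Set V) (i : V) : V → Bool → Prop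
  | start : Reach G S i i false
  | down {v w : V} {b : Bool} : Reach G S i v b → v ∉ S → G.Adj v w → Reach G S i w true
  | up {v w : V} : Reach G S i v false → v ∉ S → G.Adj w v → Reach G S i w false
  | collide {v w : V} : Reach G S i v true → v ∈ S → G.Adj w v → Reach G S i w false

/-- A walk all of whose vertices but the last satisfy the condition for being open, where colliders
only need a descendant in `S`; `d` tells whether the walk is entered along an edge pointing to its
first vertex. -/
def Active (G : Digraph V) (S : Set V) : Prop → ∀ {v j : V},
    G.toSimpleGraphInclusive.Walk v j → Prop
  | _, _, _, .nil => True
  | d, v, _, .cons (v := w) _ p =>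
    (G.Adj v w → v ∉ S) ∧
      (G.Adj w v → (d → ∃ s ∈ S, IsDescendant G v s) ∧ (¬ d → v ∉ S)) ∧ Active G S (G.Adj v w) p

/-- The ball rolls down a directed path until it first meets `S`, bounces at that collider and
climbs back. Hence a collider with a descendant in `S` is as good as one in `S`. -/
lemma Reach.bounce {G : Digraph V} {S : Set V} {i v s : V} (hs : s ∈ S)
    (hd : IsDescendant G v s) (h : Reach G S i v true) : v ∈ S ∨ Reach G S i v false := by
  induction hd using Relation.ReflTransGen.head_induction_on with
  | refl => exact .inl hs
  | @head a c hac _ ih =>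
    by_cases ha : a ∈ S
    · exact .inl ha
    · have hc := h.down ha hac
      by_cases hcS : c ∈ S
      · exact .inr (hc.collide hcS hac)
      · exact .inr (((ih hc).resolve_left hcS).up hcS hac)

lemma Active.reach {G : Digraph V} {S : Set V} {i v j : V}
    (p : G.toSimpleGraphInclusive.Walk v j) (hG : IsDAG G) :
    ∀ {d : Prop} {b : Bool}, (d ↔ b = true) → Active G S d p → Reach G S i v b →
      ∃ b', Reach G S i j b' := by
  induction p with
  | nil => exact fun {_ b} _ _ h => ⟨b, h⟩
  | @cons v w j hvw p ih =>
    intro d b hd ⟨h1, h2, h3⟩ h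
    rcases linked_of_skeleton_adj hvw with hE | hE
    · exact ih (b := true) (by simp [hE]) h3 (h.down (h1 hE) hE)
    · have hn : ¬ G.Adj v w := hG.asymm hE
      refine ih (b := false) (by simp [hn]) h3 ?_
      cases b with
      | false => exact h.up ((h2 hE).2 (by simp [hd])) hE
      | true =>
        obtain ⟨s, hs, hvs⟩ := (h2 hE).1 (by simp [hd])
        by_cases hv : v ∈ S
        · exact h.collide hv hE
        · exact ((h.bounce hs hvs).resolve_left hv).up hv hE

lemma Reach.exists_active {G : Digraph V} (hG : IsDAG G) {S : Set V} {i v j : V} {b : Bool}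
    (h : Reach G S i v b) : ∀ p : G.toSimpleGraphInclusive.Walk v j,
      Active G S (b = true) p → ∃ q : G.toSimpleGraphInclusive.Walk i j, Active G S False q := by
  induction h with
  | start => exact fun p hp => ⟨p, by simpa using hp⟩
  | @down v w b _ hv hE ih =>
    intro p hp
    refine ih (.cons (skeleton_adj hG (.inl hE)) p) ⟨fun _ => hv, fun h' => ?_, ?_⟩
    · exact absurd h' (hG.asymm hE)
    · simpa [hE] using hp
  | @up v w _ hv hE ih =>
    intro p hp
    have hn : ¬ G.Adj v w := hG.asymm hE
    refine ih (.cons (skeleton_adj hG (.inr hE)) p)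
      ⟨fun _ => hv, fun h' => ⟨by simp, fun _ => hv⟩, ?_⟩
    simpa [hn] using hp
  | @collide v w _ hv hE ih =>
    intro p hp
    have hn : ¬ G.Adj v w := hG.asymm hE
    refine ih (.cons (skeleton_adj hG (.inr hE)) p)
      ⟨fun h' => absurd h' hn, fun h' => ⟨fun _ => ⟨v, hv, .refl⟩, by simp⟩, ?_⟩
    simpa [hn] using hp

/-- The walk keeps following edge directions until it reaches `v` or turns at a collider, which has
a descendant in `S`. -/
lemma Active.descendant_or {G : Digraph V} {S : Set V} {w j v : V}
    (p : G.toSimpleGraphInclusive.Walk w j) : ∀ {d : Prop}, d → Active G S d p → v ∈ p.support →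
      (∃ s ∈ S, IsDescendant G w s) ∨ IsDescendant G w v := by
  induction p with
  | nil =>
    intro d _ _ hv
    simp only [SimpleGraph.Walk.support_nil, List.mem_singleton] at hv
    exact .inr (hv ▸ .refl)
  | @cons w u j hwu p ih =>
    intro d hd ⟨_, h2, h3⟩ hv
    rw [SimpleGraph.Walk.support_cons, List.mem_cons] at hv
    rcases linked_of_skeleton_adj hwu with hE | hE
    · rcases hv with rfl | hv
      · exact .inr .refl
      · rcases ih hE h3 hv with ⟨s, hs, hus⟩ | huv
        · exact .inl ⟨s, hs, .head hE hus⟩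
        · exact .inr (.head hE huv)
    · exact .inl ((h2 hE).1 hd)

lemma Active.exists_suffix {G : Digraph V} {S : Set V} {w j v : V}
    (p : G.toSimpleGraphInclusive.Walk w j) : ∀ {d : Prop}, Active G S d p → p.IsPath →
      v ∈ p.support → ∃ (d' : Prop) (q : G.toSimpleGraphInclusive.Walk v j),
        Active G S d' q ∧ q.IsPath := by
  induction p with
  | nil =>
    intro d h hp hv
    simp only [SimpleGraph.Walk.support_nil, List.mem_singleton] at hv
    subst hv
    exact ⟨d, .nil, h, hp⟩
  | @cons w u j hwu p ih =>
    intro d h hp hv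
    rw [SimpleGraph.Walk.support_cons, List.mem_cons] at hv
    rcases hv with rfl | hv
    · exact ⟨d, _, h, hp⟩
    · exact ih h.2.2 hp.of_cons hv

/-- Cutting the loops of an active walk keeps it active. -/
lemma Active.exists_path {G : Digraph V} (hG : IsDAG G) {S : Set V} {v j : V}
    (p : G.toSimpleGraphInclusive.Walk v j) : ∀ {d : Prop}, Active G S d p →
      ∃ q : G.toSimpleGraphInclusive.Walk v j, q.IsPath ∧ Active G S d q := by
  induction p with
  | nil => exact fun h => ⟨.nil, .nil, h⟩
  | @cons v w j hvw p ih =>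
    intro d ⟨h1, h2, h3⟩
    obtain ⟨q, hq, hqA⟩ := ih h3
    by_cases hv : v ∈ q.support
    · obtain ⟨d', r, hr, hrp⟩ := Active.exists_suffix q hqA hq hv
      refine ⟨r, hrp, ?_⟩
      cases r with
      | nil => trivial
      | @cons _ u _ hvu r =>
        obtain ⟨g1, g2, g3⟩ := hr
        refine ⟨g1, fun hE => ⟨fun hd => ?_, fun hd => ?_⟩, g3⟩
        -- Cutting the loop may turn `v` into a collider. If the loop left `v` downwards, it met a
        -- collider below `v`, which supplies the descendant in `S`; otherwise it would be a
        -- directed cycle.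
        · rcases linked_of_skeleton_adj hvw with hF | hF
          · rcases Active.descendant_or q hF hqA hv with ⟨s, hs, hws⟩ | hwv
            · exact ⟨s, hs, .head hF hws⟩
            · exact absurd (Relation.TransGen.head' hF hwv) (hG v)
          · exact (h2 hF).1 hd
        · rcases linked_of_skeleton_adj hvw with hF | hF
          · exact h1 hF
          · exact (h2 hF).2 hd
    · exact ⟨.cons hvw q, hq.cons hv, h1, h2, hqA⟩

/-- The condition under which the middle vertex of three consecutive ones blocks a walk. -/
def BlockedAt (G : Digraph V) (S : Set V) (a c b : V) : Prop :=
  (((G.Adj a c ∧ G.Adj c b) ∨ (G.Adj c a ∧ G.Adj b c) ∨ (G.Adj c a ∧ G.Adj c b)) ∧ c ∈ S) ∨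
    ((G.Adj a c ∧ G.Adj b c) ∧ ∀ d : V, IsDescendant G c d → d ∉ S)

lemma Active.not_blockedAt {G : Digraph V} (hG : IsDAG G) {S : Set V} {v j a c b : V}
    (p : G.toSimpleGraphInclusive.Walk v j) : ∀ {d : Prop}, Active G S d p →
      [a, c, b] <:+: p.support → ¬ BlockedAt G S a c b := by
  induction p with
  | nil =>
    intro d _ h
    exact absurd h.length_le (by simp)
  | @cons v w j hvw p ih =>
    intro d ⟨h1, h2, h3⟩ h
    rw [SimpleGraph.Walk.support_cons, List.infix_cons_iff] at h
    rcases h with h | h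
    · cases p with
      | nil => exact absurd h.length_le (by simp)
      | @cons _ u _ hwu r =>
        obtain ⟨g1, g2, g3⟩ := h3
        rw [SimpleGraph.Walk.support_cons, List.cons_prefix_cons, List.cons_prefix_cons] at h
        obtain ⟨rfl, rfl, h⟩ := h
        have : b = u := by
          cases r <;> simp at h <;> exact h
        subst this
        rintro (⟨h, hc⟩ | ⟨⟨hac, hbc⟩, hdesc⟩)
        · rcases h with ⟨-, h⟩ | ⟨h, h'⟩ | ⟨-, h⟩
          · exact g1 h hc
          · exact (g2 h').2 (hG.asymm h) hc
          · exact g1 h hc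
        · obtain ⟨s, hs, hcs⟩ := (g2 hbc).1 hac
          exact hdesc s hcs hs
    · exact ih h3 h

lemma active_of_not_blocked {G : Digraph V} {S : Set V} {v w j : V}
    (p : G.toSimpleGraphInclusive.Walk w j) : ∀ (h : G.toSimpleGraphInclusive.Adj v w),
      ¬ IsBlocked G S (.cons h p) → Active G S (G.Adj v w) p := by
  induction p generalizing v with
  | nil => exact fun _ _ => trivial
  | @cons w u j hwu p ih =>
    intro h hb
    have hmid : ¬ BlockedAt G S v w u := by
      refine fun hB => hb ⟨v, w, u, List.IsPrefix.isInfix ?_, hB⟩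
      cases p <;> simp
    refine ⟨fun hE hw => hmid (.inl ⟨?_, hw⟩), fun hE => ⟨fun hd => ?_, fun hd hw => ?_⟩,
      ih hwu fun ⟨a, c, b, hi, hB⟩ => hb ⟨a, c, b, ?_, hB⟩⟩
    · rcases linked_of_skeleton_adj h with hF | hF
      · exact .inl ⟨hF, hE⟩
      · exact .inr (.inr ⟨hF, hE⟩)
    · by_contra hcon
      exact hmid (.inr ⟨⟨hd, hE⟩, fun s hs hsS => hcon ⟨s, hsS, hs⟩⟩)
    · exact hmid (.inl ⟨.inr (.inl ⟨(linked_of_skeleton_adj h).resolve_left hd, hE⟩), hw⟩)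
    · rw [SimpleGraph.Walk.support_cons]
      exact List.infix_cons hi

/-- d-connection is reachability by the Bayes ball. -/
lemma not_dSep_iff {G : Digraph V} (hG : IsDAG G) {S : Set V} {i j : V} (hi : i ∉ S) :
    ¬ DSep G i j S ↔ ∃ b, Reach G S i j b := by
  constructor
  · intro h
    simp only [DSep, not_forall] at h
    obtain ⟨p, hp, hb⟩ := h
    refine Active.reach p hG (d := False) (b := false) (by simp) ?_ .start
    cases p with
    | nil => trivial
    | cons h p =>
      exact ⟨fun _ => hi, fun _ => ⟨False.elim, fun _ => hi⟩, active_of_not_blocked p h hb⟩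
  · rintro ⟨b, hb⟩ h
    obtain ⟨q, hq⟩ := hb.exists_active hG .nil trivial
    obtain ⟨r, hr, hrA⟩ := Active.exists_path hG q hq
    obtain ⟨a, c, b, hi, hB⟩ := h r hr
    exact Active.not_blockedAt hG r hrA hi hB

/-! ### Markov equivalence determines the skeleton and the v-structures -/

/-- The same skeleton and the same v-structures. -/
structure SameStructure (G H : Digraph V) : Prop where
  linked : ∀ a b, Linked G a b ↔ Linked H a b
  vstruct : ∀ a c b, a ≠ b → ¬ Linked G a b →
    (G.Adj a c ∧ G.Adj b c ↔ H.Adj a c ∧ H.Adj b c)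

lemma SameStructure.symm {G H : Digraph V} (h : SameStructure G H) : SameStructure H G :=
  ⟨fun a b => (h.linked a b).symm,
    fun a c b hab hl => (h.vstruct a c b hab (by rwa [h.linked])).symm⟩

lemma SameStructure.trans {G H K : Digraph V} (h : SameStructure G H) (h' : SameStructure H K) :
    SameStructure G K :=
  ⟨fun a b => (h.linked a b).trans (h'.linked a b),
    fun a c b hab hl => (h.vstruct a c b hab hl).trans
      (h'.vstruct a c b hab (by rwa [← h.linked]))⟩

lemma BlockedAt.symm {G : Digraph V} {S : Set V} {a c b : V} (h : BlockedAt G S a c b) :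
    BlockedAt G S b c a := by
  unfold BlockedAt at *; tauto

lemma DSep.symm {G : Digraph V} {S : Set V} {i j : V} (h : DSep G i j S) : DSep G j i S := by
  intro p hp
  obtain ⟨a, c, b, hi, hB⟩ := h p.reverse hp.reverse
  refine ⟨b, c, a, ?_, BlockedAt.symm hB⟩
  rw [SimpleGraph.Walk.support_reverse] at hi
  simpa using List.reverse_infix.2 hi

lemma markovEquiv_iff {G H : Digraph V} :
    MarkovEquiv G H ↔
      ∀ i j S, i ≠ j → i ∉ S → j ∉ S → (DSep G i j S ↔ DSep H i j S) := by
  simp only [MarkovEquiv, dSeparations, Set.ext_iff, Prod.forall, Set.mem_ofPred_eq]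
  exact forall_congr' fun i => forall_congr' fun j => forall_congr' fun S => by tauto

/-- A vertex is d-separated by its parents from every non-descendant that is not a parent. -/
lemma dSep_parents {G : Digraph V} (hG : IsDAG G) {i j : V} (hij : i ≠ j)
    (hl : ¬ G.Adj j i) (hd : ¬ IsDescendant G i j) : DSep G i j {p | G.Adj p i} := by
  by_contra hcon
  obtain ⟨b, hb⟩ := (not_dSep_iff hG (S := {p | G.Adj p i}) (hG.irrefl i)).1 hcon
  -- A ball at a parent of `i` came from a child and is stopped there. Below `i` it can only
  -- descend, since a collider in `S` would be a parent of `i` below `i`.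
  have key : ∀ v b, Reach G {p | G.Adj p i} i v b →
      (v = i ∧ b = false) ∨ (G.Adj v i ∧ b = false) ∨
        (Relation.TransGen G.Adj i v ∧ b = true) := by
    intro v b h
    induction h with
    | start => simp
    | @down v w b _ hv hE ih =>
      rcases ih with ⟨rfl, -⟩ | ⟨h, -⟩ | ⟨h, -⟩
      · exact .inr (.inr ⟨.single hE, rfl⟩)
      · exact absurd h hv
      · exact .inr (.inr ⟨h.tail hE, rfl⟩)
    | @up v w h0 hv hE ih =>
      rcases ih with ⟨rfl, -⟩ | ⟨h, -⟩ | ⟨-, h⟩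
      · exact .inr (.inl ⟨hE, rfl⟩)
      · exact absurd h hv
      · cases h
    | @collide v w h0 hv hE ih =>
      rcases ih with ⟨rfl, h⟩ | ⟨-, h⟩ | ⟨h, -⟩
      · cases h
      · cases h
      · exact absurd (h.tail hv) (hG i)
  rcases key j b hb with ⟨h, -⟩ | ⟨h, -⟩ | ⟨h, -⟩
  · exact hij h.symm
  · exact hl h
  · exact hd h.to_reflTransGen

/-- The separator is the parent set of whichever endpoint is not an ancestor of the other. That it
avoids common children is what makes v-structures visible. -/
lemma exists_dSep {G : Digraph V} (hG : IsDAG G) {i j : V} (hij : i ≠ j) (hl : ¬ Linked G i j) :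
    ∃ S : Set V, i ∉ S ∧ j ∉ S ∧ DSep G i j S ∧ ∀ c, G.Adj i c → G.Adj j c → c ∉ S := by
  by_cases hd : IsDescendant G i j
  · refine ⟨{p | G.Adj p j}, fun h => hl (.inl h), hG.irrefl j, ?_,
      fun c _ h => hG.asymm h⟩
    refine (dSep_parents hG hij.symm (fun h => hl (.inl h)) fun h => ?_).symm
    rcases Relation.reflTransGen_iff_eq_or_transGen.1 hd with h' | h'
    · exact hij h'.symm
    · exact hG i (h'.trans_left h)
  · exact ⟨{p | G.Adj p i}, hG.irrefl i, fun h => hl (.inr h),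
      dSep_parents hG hij (fun h => hl (.inr h)) hd, fun c h _ => hG.asymm h⟩

lemma not_dSep_of_linked {G : Digraph V} (hG : IsDAG G) {i j : V} {S : Set V}
    (hi : i ∉ S) (h : Linked G i j) : ¬ DSep G i j S := by
  rw [not_dSep_iff hG hi]
  rcases h with h | h
  · exact ⟨_, .down .start hi h⟩
  · exact ⟨_, .up .start hi h⟩

lemma not_dSep_of_noncollider {G : Digraph V} (hG : IsDAG G) {i j c : V} {S : Set V}
    (hi : i ∉ S) (hc : c ∉ S) (hic : Linked G i c) (hjc : Linked G j c)
    (h : ¬ (G.Adj i c ∧ G.Adj j c)) : ¬ DSep G i j S := by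
  rw [not_dSep_iff hG hi]
  rcases hjc with hjc | hjc
  · have hic := hic.resolve_left fun h' => h ⟨h', hjc⟩
    exact ⟨_, .up (.up .start hi hic) hc hjc⟩
  · rcases hic with hic | hic
    · exact ⟨_, .down (.down .start hi hic) hc hjc⟩
    · exact ⟨_, .down (.up .start hi hic) hc hjc⟩

lemma MarkovEquiv.linked_imp {G H : Digraph V} (hG : IsDAG G) (hH : IsDAG H)
    (h : MarkovEquiv G H) {a b : V} (hl : Linked G a b) : Linked H a b := by
  by_contra hcon
  have hab := hl.ne hG
  obtain ⟨S, ha, hb, hS, -⟩ := exists_dSep hH hab hcon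
  exact not_dSep_of_linked hG ha hl ((markovEquiv_iff.1 h a b S hab ha hb).2 hS)

lemma MarkovEquiv.vstruct_imp {G H : Digraph V} (hG : IsDAG G) (hH : IsDAG H)
    (h : MarkovEquiv G H) {a b c : V} (hab : a ≠ b) (hl : ¬ Linked G a b) (hac : G.Adj a c)
    (hbc : G.Adj b c) : H.Adj a c ∧ H.Adj b c := by
  by_contra hcon
  obtain ⟨S, ha, hb, hS, hc⟩ := exists_dSep hG hab hl
  exact not_dSep_of_noncollider hH ha (hc c hac hbc) (h.linked_imp hG hH (.inl hac))
    (h.linked_imp hG hH (.inl hbc)) hcon ((markovEquiv_iff.1 h a b S hab ha hb).1 hS)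

lemma MarkovEquiv.sameStructure {G H : Digraph V} (hG : IsDAG G) (hH : IsDAG H)
    (h : MarkovEquiv G H) : SameStructure G H := by
  have h' : MarkovEquiv H G := Eq.symm h
  have hl : ∀ a b, Linked G a b ↔ Linked H a b := fun a b =>
    ⟨h.linked_imp hG hH, h'.linked_imp hH hG⟩
  exact ⟨hl, fun a c b hab hn => ⟨fun hh => h.vstruct_imp hG hH hab hn hh.1 hh.2,
    fun hh => h'.vstruct_imp hH hG hab (by rwa [← hl]) hh.1 hh.2⟩⟩

/-! ### Reversing covered edges, and the converse of the criterion -/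

/-- `H` arises from `G` by reversing the edge `a → b`, where `a` and `b` have the same other
parents. -/
structure CoveredFlip (G H : Digraph V) (a b : V) : Prop where
  adj : G.Adj a b
  adj' : H.Adj b a
  not_adj : ¬ G.Adj b a
  not_adj' : ¬ H.Adj a b
  agree : ∀ x y, ¬ (x = a ∧ y = b) → ¬ (x = b ∧ y = a) → (G.Adj x y ↔ H.Adj x y)
  covered : ∀ c, c ≠ a → c ≠ b → (G.Adj c a ↔ G.Adj c b)

lemma CoveredFlip.symm {G H : Digraph V} {a b : V} (h : CoveredFlip G H a b) (hab : a ≠ b) :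
    CoveredFlip H G b a where
  adj := h.adj'
  adj' := h.adj
  not_adj := h.not_adj'
  not_adj' := h.not_adj
  agree x y h1 h2 := (h.agree x y h2 h1).symm
  covered c h1 h2 := by
    rw [← h.agree c b (by tauto) (by tauto), ← h.agree c a (by tauto) (by tauto)]
    exact (h.covered c h2 h1).symm

/-- Invariant for simulating the ball of `G` in `H`. A third vertex that is a parent of `a` or `b`
is a parent of both, so a ball arriving from it reaches both ends. When the ball of `G` crosses the
edge itself, the ball of `H` may have to lag at the other end; the disjunctions list these
positions. -/
lemma CoveredFlip.reach {G H : Digraph V} {a b : V} (hG : IsDAG G)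
    (h : CoveredFlip G H a b) {S : Set V} {i v : V} {m : Bool} (hr : Reach G S i v m) :
    (v ≠ a → v ≠ b → Reach H S i v m) ∧
    (v = a → m = true → Reach H S i a true ∧ Reach H S i b true) ∧
    (v = b → m = false → Reach H S i b false) ∧
    (v = a → m = false → Reach H S i a false ∨ (b ∉ S ∧ Reach H S i b false) ∨
      (b ∈ S ∧ Reach H S i a true ∧ Reach H S i b true)) ∧
    (v = b → m = true → (Reach H S i a true ∧ Reach H S i b true) ∨
      (a ∉ S ∧ Reach H S i a false) ∨ (a ∉ S ∧ b ∉ S ∧ Reach H S i b false)) := by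
  obtain ⟨hab, hba, nba, nab, agree, cov⟩ := h
  have hne : a ≠ b := fun e => hG.irrefl a (e ▸ hab)
  have cov' : ∀ c, c ≠ a → c ≠ b → (G.Adj c a → H.Adj c a ∧ H.Adj c b) ∧
      (G.Adj c b → H.Adj c a ∧ H.Adj c b) := by grind
  have other : ∀ x y, y ≠ a → y ≠ b → (G.Adj x y → H.Adj x y) := by grind
  have other' : ∀ x y, x ≠ a → x ≠ b → (G.Adj x y → H.Adj x y) := by grind
  have irr := hG.irrefl
  clear agree cov
  induction hr with
  | start =>
    have := Reach.start (G := H) (S := S) (i := i)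
    grind
  | @down v w m h0 hv hE ih =>
    have D := fun v w m => Reach.down (G := H) (S := S) (i := i) (v := v) (w := w) (b := m)
    have U := fun v w => Reach.up (G := H) (S := S) (i := i) (v := v) (w := w)
    have C := fun v w => Reach.collide (G := H) (S := S) (i := i) (v := v) (w := w)
    clear h0
    by_cases hva : v = a
    · subst hva
      by_cases hwb : w = b
      · grind
      · grind
    · by_cases hvb : v = b
      · subst hvb
        grind
      · grind
  | @up v w h0 hv hE ih =>
    have D := fun v w m => Reach.down (G := H) (S := S) (i := i) (v := v) (w := w) (b := m)
    have U := fun v w => Reach.up (G := H) (S := S) (i := i) (v := v) (w := w)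
    have C := fun v w => Reach.collide (G := H) (S := S) (i := i) (v := v) (w := w)
    clear h0
    by_cases hva : v = a
    · subst hva
      grind
    · by_cases hvb : v = b
      · subst hvb
        by_cases hwa : w = a
        · grind
        · grind
      · grind
  | @collide v w h0 hv hE ih =>
    have D := fun v w m => Reach.down (G := H) (S := S) (i := i) (v := v) (w := w) (b := m)
    have U := fun v w => Reach.up (G := H) (S := S) (i := i) (v := v) (w := w)
    have C := fun v w => Reach.collide (G := H) (S := S) (i := i) (v := v) (w := w)
    clear h0
    by_cases hva : v = a
    · subst hva
      grind
    · by_cases hvb : v = b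
      · subst hvb
        by_cases hwa : w = a
        · grind
        · grind
      · grind

lemma CoveredFlip.dSep {G H : Digraph V} {a b : V} (hG : IsDAG G) (hH : IsDAG H)
    (h : CoveredFlip G H a b) {S : Set V} {i j : V} (hi : i ∉ S) (hj : j ∉ S)
    (hd : DSep H i j S) : DSep G i j S := by
  by_contra hcon
  obtain ⟨m, hm⟩ := (not_dSep_iff hG hi).1 hcon
  refine (not_dSep_iff hH hi).2 ?_ hd
  obtain ⟨h1, h2, h3, h4, h5⟩ := h.reach hG hm
  have D := fun v w m => Reach.down (G := H) (S := S) (i := i) (v := v) (w := w) (b := m)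
  have := h.adj'
  have U := fun v w => Reach.up (G := H) (S := S) (i := i) (v := v) (w := w)
  by_cases hja : j = a
  · subst hja
    cases m <;> grind
  · by_cases hjb : j = b
    · subst hjb
      cases m <;> grind
    · exact ⟨m, h1 hja hjb⟩

lemma CoveredFlip.markovEquiv {G H : Digraph V} {a b : V} (hG : IsDAG G) (hH : IsDAG H)
    (h : CoveredFlip G H a b) : MarkovEquiv G H := by
  have hab : a ≠ b := fun e => hG.irrefl a (by simpa [← e] using h.adj)
  exact markovEquiv_iff.2 fun i j S _ hi hj =>
    ⟨(h.symm hab).dSep hH hG hi hj, h.dSep hG hH hi hj⟩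

/-- The graph with the edge `a → b` reversed. -/
def reverseEdge (G : Digraph V) (a b : V) : Digraph V where
  Adj x y := (G.Adj x y ∧ ¬ (x = a ∧ y = b)) ∨ (x = b ∧ y = a)

lemma coveredFlip_reverseEdge {G : Digraph V} (hG : IsDAG G) {a b : V} (hab : G.Adj a b)
    (hc : ∀ c, c ≠ a → c ≠ b → (G.Adj c a ↔ G.Adj c b)) :
    CoveredFlip G (reverseEdge G a b) a b where
  adj := hab
  adj' := .inr ⟨rfl, rfl⟩
  not_adj := hG.asymm hab
  not_adj' := by
    rintro (⟨-, h⟩ | ⟨rfl, -⟩)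
    · exact h ⟨rfl, rfl⟩
    · exact hG.irrefl _ hab
  agree x y h1 h2 := by simp only [reverseEdge, h1, h2, not_false_eq_true, and_true, or_false]
  covered := hc

lemma isDAG_reverseEdge {G : Digraph V} (hG : IsDAG G) {a b : V} (hab : G.Adj a b)
    (hc : ∀ c, c ≠ a → c ≠ b → (G.Adj c a ↔ G.Adj c b)) : IsDAG (reverseEdge G a b) := by
  have key : ∀ x y, x ≠ b → Relation.TransGen (reverseEdge G a b).Adj x y →
      Relation.TransGen G.Adj x y ∧ (y = b → Relation.TransGen G.Adj x a) := by
    intro x y hx h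
    have step : ∀ p, G.Adj p b → ¬ (p = a ∧ b = b) → G.Adj p a := fun p hp hpa =>
      (hc p (by tauto) (by rintro rfl; exact hG.irrefl _ hp)).2 hp
    induction h with
    | single h =>
      rcases h with ⟨h, h'⟩ | ⟨h, -⟩
      · exact ⟨.single h, by rintro rfl; exact .single (step _ h h')⟩
      · exact absurd h hx
    | tail _ h ih =>
      rcases h with ⟨h, h'⟩ | ⟨rfl, rfl⟩
      · exact ⟨ih.1.tail h, by rintro rfl; exact ih.1.tail (step _ h h')⟩
      · exact ⟨ih.2 rfl, by rintro rfl; exact (hG.irrefl _ hab).elim⟩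
  intro x hx
  by_cases hxb : x = b
  · subst hxb
    obtain ⟨w, hw, hwx⟩ := Relation.TransGen.head'_iff.1 hx
    have hwb : w ≠ x := by
      rintro rfl
      rcases hw with ⟨hw, -⟩ | ⟨-, rfl⟩
      · exact hG.irrefl _ hw
      · exact hG.irrefl _ hab
    exact hG w (key w w hwb (.tail' hwx hw)).1
  · exact hG x (key x x hxb hx).1

/-- Two different DAGs with the same skeleton and the same v-structures differ on some edge that is
covered in the first one. -/
lemma SameStructure.exists_covered [Finite V] {G H : Digraph V} (hG : IsDAG G) (hH : IsDAG H)
    (h : SameStructure G H) {x y : V} (hxy : G.Adj x y) (hyx : H.Adj y x) :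
    ∃ a b, G.Adj a b ∧ H.Adj b a ∧ ∀ c, c ≠ a → c ≠ b → (G.Adj c a ↔ G.Adj c b) := by
  have : Std.Irrefl (Relation.TransGen G.Adj) := ⟨hG⟩
  have : Std.Irrefl (Function.swap (Relation.TransGen G.Adj)) := ⟨hG⟩
  have : IsTrans V (Function.swap (Relation.TransGen G.Adj)) :=
    ⟨fun a b c h h' => Relation.TransGen.trans h' h⟩
  have wf := Finite.wellFounded_of_trans_of_irrefl (Relation.TransGen G.Adj)
  have wf' := Finite.wellFounded_of_trans_of_irrefl (Function.swap (Relation.TransGen G.Adj))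
  -- Among the edges on which the graphs differ, take a head `b` that is most upstream in `G`, then
  -- for it a tail `a` that is most downstream.
  obtain ⟨b, ⟨a₀, ha₀⟩, hbmin⟩ := wf.has_min {b | ∃ a, G.Adj a b ∧ H.Adj b a} ⟨y, x, hxy, hyx⟩
  obtain ⟨a, ⟨hab, hba⟩, hamax⟩ := wf'.has_min {a | G.Adj a b ∧ H.Adj b a} ⟨a₀, ha₀⟩
  have same : ∀ c d, Relation.TransGen G.Adj d b → G.Adj c d → H.Adj c d := by
    intro c d hd hcd
    by_contra hn
    exact hbmin d ⟨c, hcd, ((h.linked c d).1 (.inl hcd)).resolve_left hn⟩ hd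
  refine ⟨a, b, hab, hba, fun c hca hcb => ⟨fun hc => ?_, fun hc => ?_⟩⟩
  · have hc' := same c a (.single hab) hc
    by_cases hl : Linked G c b
    · exact hl.resolve_right (hG.no_triangle hc hab)
    · exact absurd ((h.vstruct c a b hcb hl).2 ⟨hc', hba⟩).2 (hG.asymm hab)
  · by_cases hl : Linked G c a
    · refine hl.resolve_right fun hac => ?_
      have hac' := same a c (.single hc) hac
      have hbc' : H.Adj b c :=
        ((h.linked c b).1 (.inl hc)).resolve_left (hH.no_triangle hba hac')
      exact hamax c ⟨hc, hbc'⟩ (.single hac)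
    · exact absurd ((h.vstruct c b a hca hl).1 ⟨hc, hab⟩).2 (hH.asymm hba)

lemma sameStructure_reverseEdge {G : Digraph V} (hG : IsDAG G) {a b : V} (hab : G.Adj a b)
    (hc : ∀ c, c ≠ a → c ≠ b → (G.Adj c a ↔ G.Adj c b)) :
    SameStructure (reverseEdge G a b) G :=
  (((coveredFlip_reverseEdge hG hab hc).markovEquiv hG
    (isDAG_reverseEdge hG hab hc)).sameStructure hG (isDAG_reverseEdge hG hab hc)).symm

/-- DAGs with the same skeleton and the same v-structures are Markov equivalent. -/
lemma SameStructure.markovEquiv [Finite V] {G H : Digraph V} (hG : IsDAG G) (hH : IsDAG H)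
    (h : SameStructure G H) : MarkovEquiv G H := by
  induction hn : {e : V × V | G.Adj e.1 e.2 ∧ H.Adj e.2 e.1}.ncard using Nat.strong_induction_on
    generalizing G with
  | _ n ih =>
    by_cases hD : ∃ x y, G.Adj x y ∧ H.Adj y x
    · obtain ⟨x, y, hxy, hyx⟩ := hD
      obtain ⟨a, b, hab, hba, hc⟩ := h.exists_covered hG hH hxy hyx
      have hK := isDAG_reverseEdge hG hab hc
      refine ((coveredFlip_reverseEdge hG hab hc).markovEquiv hG hK).trans
        (ih _ ?_ hK ((sameStructure_reverseEdge hG hab hc).trans h) rfl)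
      rw [← hn]
      refine Set.ncard_lt_ncard ⟨?_, fun hsub => ?_⟩ (Set.toFinite _)
      · rintro ⟨u, w⟩ ⟨⟨h1, -⟩ | ⟨h1, h1'⟩, h2⟩
        · exact ⟨h1, h2⟩
        · simp only at h1 h1' h2
          subst h1 h1'
          exact absurd h2 (hH.asymm hba)
      · rcases (hsub (show (a, b) ∈ _ from ⟨hab, hba⟩)).1 with ⟨-, h⟩ | ⟨h, -⟩
        · exact h ⟨rfl, rfl⟩
        · simp only at h
          exact hG.irrefl b (h ▸ hab)
    · push Not at hD
      have : G = H := by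
        ext u w
        refine ⟨fun hu => ?_, fun hu => ?_⟩
        · exact ((h.linked u w).1 (.inl hu)).resolve_right (hD u w hu)
        · exact ((h.linked u w).2 (.inl hu)).resolve_right fun hw => hD w u hw hu
      rw [this]
      rfl

lemma markovEquiv_iff_sameStructure [Finite V] {G H : Digraph V} (hG : IsDAG G) (hH : IsDAG H) :
    MarkovEquiv G H ↔ SameStructure G H :=
  ⟨fun h => h.sameStructure hG hH, fun h => h.markovEquiv hG hH⟩

/-! ### Interventions reveal parent sets -/

lemma isDAG_interventionalGraph {G : Digraph V} (hG : IsDAG G) (k : InterventionKind) (x : V) :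
    IsDAG (interventionalGraph k G x) := by
  have key : ∀ u w, Relation.TransGen (interventionalGraph k G x).Adj u w →
      ∃ b, w = some b ∧ ∀ a, u = some a → Relation.TransGen G.Adj a b := by
    intro u w h
    induction h with
    | @single w h =>
      cases w with
      | none => cases u <;> exact h.elim
      | some b =>
        refine ⟨b, rfl, ?_⟩
        rintro a rfl
        exact .single h.1
    | @tail v w _ h ih =>
      obtain ⟨b, rfl, ih⟩ := ih
      cases w with
      | none => exact h.elim
      | some c => exact ⟨c, rfl, fun a ha => (ih a ha).tail h.1⟩
  intro u hu
  obtain ⟨b, rfl, h⟩ := key u u hu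
  exact hG b (h b rfl)

/-- Soft: the new vertex and `y` form a v-structure at `x`. Hard: an edge `x → y` of `H` would
survive the intervention, while `y → x` is deleted from `G`. -/
lemma parent_of_sameStructure_interventionalGraph {G H : Digraph V} (hG : IsDAG G)
    (h : SameStructure G H) {k : InterventionKind} {x y : V}
    (hi : SameStructure (interventionalGraph k G x) (interventionalGraph k H x))
    (hy : G.Adj y x) : H.Adj y x := by
  have hyx : y ≠ x := fun e => hG.irrefl x (e ▸ hy)
  cases k with
  | soft =>
    have hl : ¬ Linked (interventionalGraph .soft G x) none (some y) := by
      rintro (h | h)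
      · exact hyx h
      · exact h
    exact ((hi.vstruct none (some x) (some y) (by simp) hl).1 ⟨rfl, hy, by simp⟩).2.1
  | hard =>
    refine ((h.linked y x).1 (.inl hy)).resolve_right fun hxy => ?_
    rcases (hi.linked (some x) (some y)).2 (.inl ⟨hxy, fun _ => hyx⟩) with h' | h'
    · exact hG.asymm hy h'.1
    · exact h'.2 rfl rfl

lemma sameStructure_interventionalGraph {G H : Digraph V} (hG : IsDAG G) (hH : IsDAG H)
    (h : SameStructure G H) (k : InterventionKind) {x : V} (hx : ∀ y, G.Adj y x ↔ H.Adj y x) :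
    SameStructure (interventionalGraph k G x) (interventionalGraph k H x) := by
  have hx' : ∀ y, G.Adj x y ↔ H.Adj x y := by
    exact fun y => ⟨fun hxy => ((h.linked x y).1 (.inl hxy)).resolve_right
      fun hyx => hG.asymm hxy ((hx y).2 hyx), fun hxy => ((h.linked x y).2 (.inl hxy)).resolve_right
      fun hyx => hH.asymm hxy ((hx y).1 hyx)⟩
  have hl := h.linked
  unfold Linked at hl
  refine ⟨?_, ?_⟩
  · rintro (_ | a) (_ | b)
    · rfl
    · rfl
    · rfl
    · simp only [Linked, interventionalGraph]
      have h1 := hl a b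
      by_cases ha : a = x
      · subst ha
        rw [hx b, hx' b]
      · by_cases hb : b = x
        · subst hb
          rw [hx a, hx' a]
        · tauto
  · rintro (_ | a) (_ | c) (_ | b) hab hn
    · exact absurd rfl hab
    · exact .rfl
    · exact absurd rfl hab
    · simp only [interventionalGraph]
      constructor <;> rintro ⟨rfl, h1, h2⟩
      · exact ⟨rfl, (hx _).1 h1, h2⟩
      · exact ⟨rfl, (hx _).2 h1, h2⟩
    · exact .rfl
    · exact .rfl
    · simp only [interventionalGraph]
      constructor <;> rintro ⟨⟨h1, h2⟩, rfl⟩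
      · exact ⟨⟨(hx _).1 h1, h2⟩, rfl⟩
      · exact ⟨⟨(hx _).2 h1, h2⟩, rfl⟩
    · have hne : a ≠ b := fun e => hab (congrArg some e)
      have h0 := h.vstruct a c b hne
      simp only [Linked, interventionalGraph] at hn h0 ⊢
      by_cases hc : c = x
      · subst hc
        rw [hx a, hx b]
      -- A hard intervention on `x` separates `x` from its parents `d`, which may create
      -- v-structures `d → c ← x`. They agree because `d → x → c` fixes `d → c` in both graphs.
      · have key : ∀ d, G.Adj d x → (G.Adj d c ∧ G.Adj x c ↔ H.Adj d c ∧ H.Adj x c) := by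
          intro d hd
          have hd' := (hx d).1 hd
          exact ⟨fun hh => ⟨((h.linked d c).1 (.inl hh.1)).resolve_right
            (hH.no_triangle hd' ((hx' c).1 hh.2)), (hx' c).1 hh.2⟩,
            fun hh => ⟨((h.linked d c).2 (.inl hh.1)).resolve_right
            (hG.no_triangle hd ((hx' c).2 hh.2)), (hx' c).2 hh.2⟩⟩
        simp only [ne_eq, hc, not_false_eq_true, implies_true, and_true] at hn ⊢
        by_cases hb : G.Adj b x ∧ a = x
        · obtain ⟨hb, rfl⟩ := hb
          rw [and_comm, key b hb, and_comm]
        · by_cases ha : G.Adj a x ∧ b = x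
          · obtain ⟨ha, rfl⟩ := ha
            exact key a ha
          · refine h0 fun hl => hn ?_
            rcases hl with hl | hl
            · exact .inl ⟨hl, fun _ e => ha ⟨e ▸ hl, e⟩⟩
            · exact .inr ⟨hl, fun _ e => hb ⟨e ▸ hl, e⟩⟩

lemma markovEquiv_interventionalGraph_iff [Finite V] {G H : Digraph V} (hG : IsDAG G)
    (hH : IsDAG H) (h : SameStructure G H) (k : InterventionKind) (x : V) :
    MarkovEquiv (interventionalGraph k G x) (interventionalGraph k H x) ↔
      ∀ y, G.Adj y x ↔ H.Adj y x := by
  rw [markovEquiv_iff_sameStructure (isDAG_interventionalGraph hG k x)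
    (isDAG_interventionalGraph hH k x)]
  exact ⟨fun hi y => ⟨parent_of_sameStructure_interventionalGraph hG h hi,
    parent_of_sameStructure_interventionalGraph hH h.symm hi.symm⟩,
    sameStructure_interventionalGraph hG hH h k⟩

/-! ### Orientation rules and their closure property -/

/-- The edges of `G` whose direction follows, by the orientation rules of Meek, from the
v-structures of `G` and the directions of the edges at the vertices in `T`. -/
inductive Forced (G : Digraph V) (T : Set V) : V → V → Prop
  | target_left {a b : V} : a ∈ T → G.Adj a b → Forced G T a b
  | target_right {a b : V} : b ∈ T → G.Adj a b → Forced G T a b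
  | vstruct {a b c : V} : a ≠ c → ¬ Linked G a c → G.Adj a b → G.Adj c b → Forced G T a b
  | away {a b d : V} : d ≠ b → ¬ Linked G d b → Forced G T d a → G.Adj a b → Forced G T a b
  | chain {a b d : V} : Forced G T a d → Forced G T d b → Linked G a b → Forced G T a b
  -- The direction of `a → d` need not be forced: it only records that `a` is not a collider between
  -- `d` and `e`.
  | kite {a b d e : V} : d ≠ e → ¬ Linked G d e → G.Adj d b → G.Adj e b → G.Adj a d →
      Linked G a e → Linked G a b → Forced G T a b

lemma Forced.adj {G : Digraph V} (hG : IsDAG G) {T : Set V} {a b : V} (h : Forced G T a b) :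
    G.Adj a b := by
  induction h with
  | target_left _ h => exact h
  | target_right _ h => exact h
  | vstruct _ _ h _ => exact h
  | away _ _ _ h => exact h
  | chain _ _ hl h1 h2 => exact hl.resolve_right (hG.no_triangle h1 h2)
  | kite _ _ hdb _ had _ hl => exact hl.resolve_right (hG.no_triangle had hdb)

/-- The orientation rules are sound. -/
lemma Forced.adj_of_sameStructure {G H : Digraph V} (hG : IsDAG G) (hH : IsDAG H)
    (h : SameStructure G H) {T : Set V} (hT : ∀ x ∈ T, ∀ y, G.Adj y x ↔ H.Adj y x) {a b : V}
    (hf : Forced G T a b) : H.Adj a b := by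
  induction hf with
  | @target_left a b ha hab =>
    exact ((h.linked a b).1 (.inl hab)).resolve_right
      fun hba => hG.asymm hab ((hT a ha b).2 hba)
  | @target_right a b hb hab => exact (hT b hb a).1 hab
  | @vstruct a b c hac hl hab hcb => exact ((h.vstruct a b c hac hl).1 ⟨hab, hcb⟩).1
  | @away a b d hdb hl _ hab ih =>
    exact ((h.linked a b).1 (.inl hab)).resolve_right
      fun hba => hG.asymm hab ((h.vstruct d a b hdb hl).2 ⟨ih, hba⟩).2
  | @chain a b d _ _ hl h1 h2 =>
    exact ((h.linked a b).1 hl).resolve_right (hH.no_triangle h1 h2)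
  | @kite a b d e hde hl hdb heb had hae hab =>
    obtain ⟨hdb', heb'⟩ := (h.vstruct d b e hde hl).1 ⟨hdb, heb⟩
    refine ((h.linked a b).1 hab).resolve_right fun hba => ?_
    have hda := ((h.linked a d).1 (.inl had)).resolve_left (hH.no_triangle hdb' hba)
    have hea := ((h.linked a e).1 hae).resolve_left (hH.no_triangle heb' hba)
    exact hG.asymm had ((h.vstruct d a e hde hl).2 ⟨hda, hea⟩).1

/-- An edge of the skeleton of `G` which the relation `E` does not direct. -/
def Free (G : Digraph V) (E : V → V → Prop) (a b : V) : Prop :=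
  Linked G a b ∧ ¬ E a b ∧ ¬ E b a

lemma Free.symm {G : Digraph V} {E : V → V → Prop} {a b : V} (h : Free G E a b) :
    Free G E b a := ⟨h.1.symm, h.2.2, h.2.1⟩

lemma Forced.linked_of_free {G : Digraph V} (hG : IsDAG G) {T : Set V} {a b c : V}
    (h : Forced G T a b) (hf : Free G (Forced G T) b c) : a ≠ c ∧ Linked G a c := by
  have hac : a ≠ c := by
    rintro rfl
    exact hf.2.2 h
  refine ⟨hac, ?_⟩
  by_contra hl
  rcases hf.1 with hbc | hcb
  · exact hf.2.1 (.away hac hl h hbc)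
  · exact hf.2.2 (.vstruct hac.symm (fun h' => hl h'.symm) hcb (h.adj hG))

lemma Forced.or_free {G : Digraph V} (hG : IsDAG G) {T : Set V} {a b c : V}
    (h : Forced G T a b) (hf : Free G (Forced G T) b c) :
    Forced G T a c ∨ Free G (Forced G T) a c := by
  have hl := (h.linked_of_free hG hf).2
  by_cases hac : Forced G T a c
  · exact .inl hac
  · refine .inr ⟨hl, hac, fun hca => hf.2.2 (.chain hca h hf.1.symm)⟩

/-- If `a → c` were not forced, `c` would have free edges to `a`, `b` and `d`. Either `c` is a
collider between `a` and `d`, and the v-structure rule directs `a → c`, or it is not, and the kite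
rule directs `c → b`. -/
lemma Forced.of_vstruct_of_free {G : Digraph V} (hG : IsDAG G) {T : Set V} {a b c d : V}
    (had : a ≠ d) (hl : ¬ Linked G a d) (hab : G.Adj a b) (hdb : G.Adj d b)
    (hf : Free G (Forced G T) b c) : Forced G T a c := by
  have fa : Forced G T a b := .vstruct had hl hab hdb
  have fd : Forced G T d b := .vstruct had.symm (fun h => hl h.symm) hdb hab
  refine (fa.or_free hG hf).resolve_right fun hac => ?_
  rcases fd.or_free hG hf with hdc | hdc
  · exact hl (hdc.linked_of_free hG hac.symm).2.symm
  · by_cases h : G.Adj c d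
    · exact hf.2.2 (.kite had.symm (fun h => hl h.symm) hdb hab h hac.1.symm hf.1.symm)
    · by_cases h' : G.Adj c a
      · exact hf.2.2 (.kite had hl hab hdb h' hdc.1.symm hf.1.symm)
      · exact hac.2.1 (.vstruct had hl (hac.1.resolve_right h') (hdc.1.resolve_right h))

/-- The forced edges are the directed edges of a chain graph. -/
lemma Forced.of_free {G : Digraph V} (hG : IsDAG G) {T : Set V} {a b c : V}
    (h : Forced G T a b) (hf : Free G (Forced G T) b c) : Forced G T a c := by
  -- Stated before the induction so that it generalizes with `c`; each case then only has to refute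
  -- that the edge between `a` and `c` is free.
  have hfree := (h.or_free hG hf)
  induction h generalizing c with
  | @target_left a b ha hab =>
    refine hfree.resolve_right fun hac => ?_
    rcases hac.1 with h | h
    · exact hac.2.1 (.target_left ha h)
    · exact hac.2.2 (.target_right ha h)
  | @target_right a b hb hab =>
    rcases hf.1 with h | h
    · exact absurd (.target_left hb h) hf.2.1
    · exact absurd (.target_right hb h) hf.2.2
  | @vstruct a b d had hl hab hdb => exact .of_vstruct_of_free hG had hl hab hdb hf
  | @away a b d hdb hl hda hab ih =>
    refine hfree.resolve_right fun hac => ?_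
    exact hl (((ih hac (hda.or_free hG hac)).linked_of_free hG hf.symm).2)
  | @chain a b d had hdb hl _ ih =>
    refine hfree.resolve_right fun hac => ?_
    exact hac.2.1 (.chain had (ih hf (hdb.or_free hG hf)) hac.1)
  | @kite a b d e hde hl hdb heb had hae hab =>
    refine hfree.resolve_right fun hac => ?_
    have hdc : Forced G T d c := .of_vstruct_of_free hG hde hl hdb heb hf
    have hec : Forced G T e c :=
      .of_vstruct_of_free hG hde.symm (fun h => hl h.symm) heb hdb hf
    exact hac.2.1 (.kite hde hl (hdc.adj hG) (hec.adj hG) had hae hac.1)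

/-! ### Simplicial vertices and perfect orderings -/

/-- The neighbours of `s` in `W` are pairwise adjacent. -/
def IsSimplicialIn (A : V → V → Prop) (W : Finset V) (s : V) : Prop :=
  ∀ x ∈ W, ∀ y ∈ W, A x s → A y s → x ≠ y → A x y

/-- Dirac: if every nonempty set of vertices has a simplicial one, then a set of vertices that is
not contained in a clique has a simplicial vertex outside this clique. -/
lemma exists_isSimplicialIn_notMem [DecidableEq V] {A : V → V → Prop}
    (hsymm : ∀ x y, A x y → A y x)
    (hA : ∀ W : Finset V, W.Nonempty → ∃ t ∈ W, IsSimplicialIn A W t) (W : Finset V) :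
    ∀ Q : Set V, (∀ x ∈ Q, ∀ y ∈ Q, x ≠ y → A x y) → (∃ w ∈ W, w ∉ Q) →
      ∃ s ∈ W, s ∉ Q ∧ IsSimplicialIn A W s := by
  induction W using Finset.strongInduction with
  | H W ih =>
    rintro Q hQ ⟨w, hw, hwQ⟩
    obtain ⟨t, ht, hts⟩ := hA W ⟨w, hw⟩
    by_cases htQ : t ∈ Q
    · by_cases hall : ∃ s ∈ W.erase t, s ∉ {x | x ∈ W ∧ A x t}
      -- Delete `t` and use its neighbourhood as the new clique. The vertex found is not adjacent to
      -- `t`, so it lies outside `Q` and stays simplicial when `t` returns.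
      · obtain ⟨s, hs, hsN, hss⟩ := ih (W.erase t) (Finset.erase_ssubset ht)
          {x | x ∈ W ∧ A x t} (fun x hx y hy => hts x hx.1 y hy.1 hx.2 hy.2) hall
        have hst := Finset.ne_of_mem_erase hs
        have hsW := Finset.mem_of_mem_erase hs
        have hsA : ¬ A s t := fun h => hsN ⟨hsW, h⟩
        refine ⟨s, hsW, fun h => hsA (hQ s h t htQ hst), fun x hx y hy hxs hys => ?_⟩
        refine hss x (Finset.mem_erase.2 ⟨?_, hx⟩) y (Finset.mem_erase.2 ⟨?_, hy⟩) hxs hys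
        · rintro rfl
          exact hsA (hsymm _ _ hxs)
        · rintro rfl
          exact hsA (hsymm _ _ hys)
      · have hadj : ∀ x ∈ W, x ≠ t → A x t := by
          intro x hx hxt
          by_contra hcon
          exact hall ⟨x, Finset.mem_erase.2 ⟨hxt, hx⟩, fun h => hcon h.2⟩
        refine ⟨w, hw, hwQ, fun x hx y hy _ _ hxy => ?_⟩
        by_cases hxt : x = t
        · subst hxt
          exact hsymm _ _ (hadj y hy hxy.symm)
        · by_cases hyt : y = t
          · subst hyt
            exact hadj x hx hxt
          · exact hts x hx y hy (hadj x hx hxt) (hadj y hy hyt) hxy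
    · exact ⟨t, ht, htQ, hts⟩

/-- A graph in which every nonempty set of vertices has a simplicial one can be ordered such that
a given vertex comes first and the earlier neighbours of every vertex are pairwise adjacent. -/
lemma exists_rank [DecidableEq V] {A : V → V → Prop} (hsymm : ∀ x y, A x y → A y x)
    (hA : ∀ W : Finset V, W.Nonempty → ∃ t ∈ W, IsSimplicialIn A W t) (v : V) (W : Finset V) :
    v ∈ W → ∃ r : V → ℕ, (∀ x ∈ W, x ≠ v → r v < r x) ∧ Set.InjOn r W ∧
      ∀ x ∈ W, ∀ y ∈ W, ∀ z ∈ W, A x z → A y z → r x < r z → r y < r z → x ≠ y → A x y := by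
  induction W using Finset.strongInduction with
  | H W ih =>
    intro hv
    by_cases hW : ∃ w ∈ W, w ∉ ({v} : Set V)
    · obtain ⟨s, hs, hsv, hss⟩ := exists_isSimplicialIn_notMem hsymm hA W {v}
        (by rintro x rfl y rfl h; exact absurd rfl h) hW
      replace hsv : s ≠ v := hsv
      obtain ⟨r, hr1, hr2, hr3⟩ := ih (W.erase s) (Finset.erase_ssubset hs)
        (Finset.mem_erase.2 ⟨hsv.symm, hv⟩)
      have hlt : ∀ x ∈ W, r x < W.sup r + 1 := fun x hx => Nat.lt_succ_of_le (Finset.le_sup hx)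
      -- The simplicial vertex `s ≠ v` goes last, above every old rank on `W`.
      refine ⟨Function.update r s (W.sup r + 1), ?_, ?_, ?_⟩
      · intro x hx hxv
        rw [Function.update_of_ne hsv.symm]
        by_cases hxs : x = s
        · subst hxs
          rw [Function.update_self]
          exact hlt v hv
        · rw [Function.update_of_ne hxs]
          exact hr1 x (Finset.mem_erase.2 ⟨hxs, hx⟩) hxv
      · intro x hx y hy hxy
        have hx' := hlt x hx
        have hy' := hlt y hy
        by_cases hxs : x = s <;> by_cases hys : y = s
        · rw [hxs, hys]
        · subst hxs
          rw [Function.update_self, Function.update_of_ne hys] at hxy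
          omega
        · subst hys
          rw [Function.update_self, Function.update_of_ne hxs] at hxy
          omega
        · rw [Function.update_of_ne hxs, Function.update_of_ne hys] at hxy
          exact hr2 (Finset.mem_erase.2 ⟨hxs, hx⟩) (Finset.mem_erase.2 ⟨hys, hy⟩) hxy
      · intro x hx y hy z hz hxz hyz hx' hy' hxy
        by_cases hzs : z = s
        · subst hzs
          exact hss x hx y hy hxz hyz hxy
        · have hz' := hlt z hz
          rw [Function.update_of_ne hzs] at hx' hy'
          have hxs : x ≠ s := by
            rintro rfl
            rw [Function.update_self] at hx'
            omega
          have hys : y ≠ s := by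
            rintro rfl
            rw [Function.update_self] at hy'
            omega
          rw [Function.update_of_ne hxs] at hx'
          rw [Function.update_of_ne hys] at hy'
          exact hr3 x (Finset.mem_erase.2 ⟨hxs, hx⟩) y (Finset.mem_erase.2 ⟨hys, hy⟩) z
            (Finset.mem_erase.2 ⟨hzs, hz⟩) hxz hyz hx' hy' hxy
    · have h1 : ∀ w ∈ W, w = v := fun w hw => by
        by_contra h
        exact hW ⟨w, hw, h⟩
      refine ⟨0, fun x hx h => absurd (h1 x hx) h,
        fun x hx y hy _ => (h1 x hx).trans (h1 y hy).symm,
        fun x hx y hy _ _ _ _ _ _ h => absurd ((h1 x hx).trans (h1 y hy).symm) h⟩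

/-! ### Reorienting the free edges -/

/-- Orient the edges of `G` left free by `E` along increasing values of `r`. -/
def reorient (G : Digraph V) (E : V → V → Prop) (r : V → ℕ) : Digraph V where
  Adj a b := E a b ∨ (Free G E a b ∧ r a < r b)

/-- Free steps following an `E`-step can be absorbed into it by `hC`. So a cycle using `E` yields a
cycle of `E`-edges in `G`, and a cycle of free edges would increase `r`. -/
lemma isDAG_reorient {G : Digraph V} (hG : IsDAG G) {E : V → V → Prop}
    (hE : ∀ a b, E a b → G.Adj a b) (hC : ∀ a b c, E a b → Free G E b c → E a c) (r : V → ℕ) :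
    IsDAG (reorient G E r) := by
  have push : ∀ a b c, Relation.TransGen E a b → Free G E b c → Relation.TransGen E a c := by
    intro a b c h hf
    obtain ⟨d, had, hdb⟩ := Relation.TransGen.tail'_iff.1 h
    exact .tail' had (hC _ _ _ hdb hf)
  have key : ∀ a b, Relation.TransGen (reorient G E r).Adj a b →
      (r a < r b ∧ Relation.ReflTransGen (Free G E) a b) ∨
        ∃ a', Relation.ReflTransGen (Free G E) a a' ∧ Relation.TransGen E a' b := by
    intro a b h
    induction h with
    | single h =>
      rcases h with h | h
      · exact .inr ⟨a, .refl, .single h⟩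
      · exact .inl ⟨h.2, .single h.1⟩
    | tail _ h ih =>
      rcases ih with ⟨ih, ih'⟩ | ⟨a', h1, h2⟩
      · rcases h with h | h
        · exact .inr ⟨_, ih', .single h⟩
        · exact .inl ⟨ih.trans h.2, ih'.tail h.1⟩
      · rcases h with h | h
        · exact .inr ⟨a', h1, h2.tail h⟩
        · exact .inr ⟨a', h1, push _ _ _ h2 h.1⟩
  intro v hv
  rcases key v v hv with ⟨h, -⟩ | ⟨a, h1, h2⟩
  · exact lt_irrefl _ h
  · have : Relation.TransGen E a a := by
      clear hv key
      revert h2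
      suffices ∀ w, Relation.TransGen E a w → Relation.ReflTransGen (Free G E) w a →
          Relation.TransGen E a a from fun h2 => this v h2 h1
      intro w h2 h1
      induction h1 using Relation.ReflTransGen.head_induction_on with
      | refl => exact h2
      | head hf _ ih => exact ih (push _ _ _ h2 hf)
    exact hG a (this.lift id hE)

/-- If `E` contains the v-structures of `G` and directs a chain graph, then every edge of `G`
outside `E` can be reversed without changing the skeleton, the v-structures and the edges in `E`. -/
lemma exists_reversal [Finite V] {G : Digraph V} (hG : IsDAG G) {E : V → V → Prop}
    (hE : ∀ a b, E a b → G.Adj a b)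
    (hv : ∀ a b c, a ≠ c → ¬ Linked G a c → G.Adj a b → G.Adj c b → E a b)
    (hC : ∀ a b c, E a b → Free G E b c → E a c) {u v : V} (huv : G.Adj u v) (hn : ¬ E u v) :
    ∃ H, IsDAG H ∧ SameStructure H G ∧ (∀ a b, E a b → H.Adj a b) ∧ H.Adj v u := by
  classical
  have := Fintype.ofFinite V
  -- A vertex of `W` most downstream in `G` is simplicial: its free neighbours in `W` are parents,
  -- two nonadjacent ones would form a v-structure, which lies in `E`, and an `E`-edge between two
  -- of them would by `hC` direct an edge to `t`.
  have hsimp : ∀ W : Finset V, W.Nonempty → ∃ t ∈ W, IsSimplicialIn (Free G E) W t := by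
    rintro W ⟨w, hw⟩
    have : Std.Irrefl (Function.swap (Relation.TransGen G.Adj)) := ⟨hG⟩
    have : IsTrans V (Function.swap (Relation.TransGen G.Adj)) :=
      ⟨fun a b c h h' => Relation.TransGen.trans h' h⟩
    obtain ⟨t, ht, htmax⟩ := (Finite.wellFounded_of_trans_of_irrefl
      (Function.swap (Relation.TransGen G.Adj))).has_min (W : Set V) ⟨w, hw⟩
    have hin : ∀ x ∈ W, Free G E x t → G.Adj x t := fun x hx h =>
      h.1.resolve_right fun h' => htmax x hx (.single h')
    refine ⟨t, ht, fun x hx y hy hxt hyt hxy => ⟨?_, ?_, ?_⟩⟩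
    · by_contra hl
      exact hxt.2.1 (hv x t y hxy hl (hin x hx hxt) (hin y hy hyt))
    · exact fun h => hxt.2.1 (hC x y t h hyt)
    · exact fun h => hyt.2.1 (hC y x t h hxt)
  -- Ranking `v` first makes the free edge point from `v` to `u`.
  obtain ⟨r, hr1, hr2, hr3⟩ := exists_rank (fun _ _ h => h.symm) hsimp v Finset.univ
    (Finset.mem_univ v)
  have hfree : Free G E u v := ⟨.inl huv, hn, fun h => hG.asymm huv (hE _ _ h)⟩
  have hl : ∀ a b, Linked (reorient G E r) a b ↔ Linked G a b := by
    intro a b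
    constructor
    · rintro ((h | h) | (h | h))
      · exact .inl (hE _ _ h)
      · exact h.1.1
      · exact .inr (hE _ _ h)
      · exact h.1.1.symm
    · intro h
      by_cases hab : E a b
      · exact .inl (.inl hab)
      · by_cases hba : E b a
        · exact .inr (.inl hba)
        · have hne : r a ≠ r b := fun e =>
            h.ne hG (hr2 (Finset.mem_coe.2 (Finset.mem_univ a))
              (Finset.mem_coe.2 (Finset.mem_univ b)) e)
          rcases lt_or_gt_of_ne hne with h' | h'
          · exact .inl (.inr ⟨⟨h, hab, hba⟩, h'⟩)
          · exact .inr (.inr ⟨⟨h.symm, hba, hab⟩, h'⟩)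
  refine ⟨reorient G E r, isDAG_reorient hG hE hC r, ⟨hl, ?_⟩, fun a b h => .inl h,
    .inr ⟨hfree.symm, hr1 u (Finset.mem_univ u) (Linked.ne hG (.inl huv))⟩⟩
  intro a c b hab hn'
  rw [hl] at hn'
  constructor
  · rintro ⟨h | h, h' | h'⟩
    · exact ⟨hE _ _ h, hE _ _ h'⟩
    · exact absurd (.inl (hE _ _ (hC _ _ _ h h'.1.symm))) hn'
    · exact absurd (.inr (hE _ _ (hC _ _ _ h' h.1.symm))) hn'
    · exact absurd (hr3 a (Finset.mem_univ a) b (Finset.mem_univ b) c (Finset.mem_univ c)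
        h.1 h'.1 h.2 h'.2 hab).1 hn'
  · rintro ⟨h, h'⟩
    exact ⟨.inl (hv _ _ _ hab hn' h h'), .inl (hv _ _ _ hab.symm (fun h => hn' h.symm) h' h)⟩

/-! ### Essential graphs and the coverage property -/

lemma mem_mec_iff [Finite V] {G H : Digraph V} (hG : IsDAG G) :
    H ∈ mec G ↔ IsDAG H ∧ SameStructure H G :=
  and_congr_right fun hH => markovEquiv_iff_sameStructure hH hG

lemma mec_eq {G Gstar : Digraph V} (hG : G ∈ mec Gstar) : mec G = mec Gstar := by
  have h : dSeparations G = dSeparations Gstar := hG.2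
  simp only [mec, MarkovEquiv, h]

lemma mem_interventionalMEC_iff [Finite V] {G H : Digraph V} (hG : IsDAG G)
    {kind : V → InterventionKind} {I : Finset V} :
    H ∈ interventionalMEC kind I G ↔
      IsDAG H ∧ SameStructure H G ∧ ∀ x ∈ I, ∀ y, H.Adj y x ↔ G.Adj y x := by
  simp only [interventionalMEC, Set.mem_ofPred_eq, mem_mec_iff hG, and_assoc]
  refine and_congr_right fun hH => and_congr_right fun h => forall_congr' fun x =>
    imp_congr_right fun _ => markovEquiv_interventionalGraph_iff hH hG h (kind x) x

lemma self_mem_interventionalMEC {G : Digraph V} (hG : IsDAG G) (kind : V → InterventionKind)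
    (I : Finset V) : G ∈ interventionalMEC kind I G :=
  ⟨⟨hG, rfl⟩, fun _ _ => rfl⟩

lemma interventionalMEC_empty (kind : V → InterventionKind) (G : Digraph V) :
    interventionalMEC kind ∅ G = mec G := by
  simp [interventionalMEC]

lemma interventionalMEC_anti (kind : V → InterventionKind) {I J : Finset V} (h : I ⊆ J)
    (G : Digraph V) : interventionalMEC kind J G ⊆ interventionalMEC kind I G :=
  fun _ hH => ⟨hH.1, fun x hx => hH.2 x (h hx)⟩

/-- The edges directed in an essential graph are those shared by all members of the class. -/
lemma mem_directedEdges_iff [Finite V] {G : Digraph V} (hG : IsDAG G)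
    {kind : V → InterventionKind} {I : Finset V} {a b : V} :
    (a, b) ∈ directedEdges (essentialGraph (interventionalMEC kind I G)) ↔
      G.Adj a b ∧ ∀ H ∈ interventionalMEC kind I G, H.Adj a b := by
  constructor
  · rintro ⟨⟨H, hH, hab⟩, hn⟩
    have key : ∀ K ∈ interventionalMEC kind I G, K.Adj a b := by
      intro K hK
      have h1 := ((mem_interventionalMEC_iff hG).1 hH).2.1
      have h2 := ((mem_interventionalMEC_iff hG).1 hK).2.1
      exact (((h1.trans h2.symm).linked a b).1 (.inl hab)).resolve_right fun h => hn ⟨K, hK, h⟩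
    exact ⟨key G (self_mem_interventionalMEC hG kind I), key⟩
  · rintro ⟨h, h'⟩
    exact ⟨⟨G, self_mem_interventionalMEC hG kind I, h⟩, fun ⟨K, hK, hba⟩ =>
      ((mem_interventionalMEC_iff hG).1 hK).1.asymm hba (h' K hK)⟩

/-- An edge directed by an experiment with several interventions is directed by one of them. -/
lemma exists_mem_directedEdges_singleton [Finite V] {G : Digraph V} (hG : IsDAG G)
    {kind : V → InterventionKind} {I : Finset V} (hI : I.Nonempty) {e : V × V}
    (he : e ∈ directedEdges (essentialGraph (interventionalMEC kind I G))) :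
    ∃ x ∈ I, e ∈ directedEdges (essentialGraph (interventionalMEC kind {x} G)) := by
  obtain ⟨u, v⟩ := e
  obtain ⟨huv, hall⟩ := (mem_directedEdges_iff hG).1 he
  by_cases hE : ∃ x ∈ I, Forced G {x} u v
  · obtain ⟨x, hx, hf⟩ := hE
    refine ⟨x, hx, (mem_directedEdges_iff hG).2 ⟨huv, fun H hH => ?_⟩⟩
    obtain ⟨hH, hS, hp⟩ := (mem_interventionalMEC_iff hG).1 hH
    refine hf.adj_of_sameStructure hG hH hS.symm fun y hy z => ?_
    rw [Set.mem_singleton_iff.1 hy]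
    exact (hp x (Finset.mem_singleton_self x) z).symm
  · exfalso
    obtain ⟨H, hH, hS, hEH, hvu⟩ := exists_reversal hG (E := fun a b => ∃ x ∈ I, Forced G {x} a b)
      (fun a b ⟨_, _, h⟩ => h.adj hG)
      -- Nonemptiness of `I` enters here: the v-structures lie in the union only if it has a member.
      (fun a b c hac hl hab hcb => hI.imp fun x hx => ⟨hx, .vstruct hac hl hab hcb⟩)
      (fun a b c ⟨x, hx, h⟩ hf => ⟨x, hx, h.of_free hG
        ⟨hf.1, fun h' => hf.2.1 ⟨x, hx, h'⟩, fun h' => hf.2.2 ⟨x, hx, h'⟩⟩⟩) huv hE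
    -- Every edge of `G` at a target `x ∈ I` is forced, so `H` keeps the parents of `x` and belongs
    -- to the interventional class.
    refine hH.asymm hvu (hall H ((mem_interventionalMEC_iff hG).2 ⟨hH, hS, fun x hx y => ?_⟩))
    refine ⟨fun h => ?_, fun h => hEH y x ⟨x, hx, .target_right rfl h⟩⟩
    refine ((hS.linked y x).1 (.inl h)).resolve_right fun h' => ?_
    exact hH.asymm h (hEH x y ⟨x, hx, .target_left rfl h'⟩)

/-- The edges oriented by an experiment are those oriented by its single interventions. -/
lemma orientedEdges_eq_biUnion [Finite V] {G Gstar : Digraph V} (hG : G ∈ mec Gstar)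
    (kind : V → InterventionKind) (I : Finset V) :
    orientedEdges Gstar kind I G = ⋃ x ∈ I, orientedEdges Gstar kind {x} G := by
  rcases I.eq_empty_or_nonempty with rfl | hI
  · simp [orientedEdges, interventionalMEC_empty, mec_eq hG]
  · ext e
    simp only [orientedEdges, Set.mem_iUnion, Set.mem_sdiff, exists_prop]
    constructor
    · rintro ⟨h, hn⟩
      obtain ⟨x, hx, hex⟩ := exists_mem_directedEdges_singleton hG.1 hI h
      exact ⟨x, hx, hex, hn⟩
    · rintro ⟨x, hx, h, hn⟩
      refine ⟨?_, hn⟩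
      rw [mem_directedEdges_iff hG.1] at h ⊢
      exact ⟨h.1, fun H hH => h.2 H (interventionalMEC_anti kind (by simpa using hx) G hH)⟩

lemma gain_insert [Finite V] [DecidableEq V] {G Gstar : Digraph V} (hG : G ∈ mec Gstar)
    (kind : V → InterventionKind) (I : Finset V) (x : V) :
    (gain Gstar kind (insert x I) G : ℝ) - gain Gstar kind I G =
      (orientedEdges Gstar kind {x} G \ orientedEdges Gstar kind I G).ncard := by
  have h : orientedEdges Gstar kind (insert x I) G =
      orientedEdges Gstar kind {x} G ∪ orientedEdges Gstar kind I G := by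
    rw [orientedEdges_eq_biUnion hG kind (insert x I), Finset.set_biUnion_insert,
      ← orientedEdges_eq_biUnion hG kind I]
  rw [gain, gain, h, ← Set.ncard_sdiff_add_ncard _ _ (Set.toFinite _) (Set.toFinite _)]
  push_cast
  ring

/-- The marginal gain counts edges of `x` not yet covered, and enlarging the experiment covers more.
-/
lemma gain_submodular [Finite V] [DecidableEq V] {G Gstar : Digraph V} (hG : G ∈ mec Gstar)
    (kind : V → InterventionKind) {I J : Finset V} (hIJ : I ⊆ J) (x : V) :
    (gain Gstar kind (insert x J) G : ℝ) - gain Gstar kind J G ≤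
      gain Gstar kind (insert x I) G - gain Gstar kind I G := by
  rw [gain_insert hG, gain_insert hG, Nat.cast_le]
  refine Set.ncard_le_ncard (Set.sdiff_subset_sdiff_right ?_) (Set.toFinite _)
  rw [orientedEdges_eq_biUnion hG kind I, orientedEdges_eq_biUnion hG kind J]
  exact Set.biUnion_subset_biUnion_left hIJ

end CausalDesign

theorem theorem2 {V : Type*} [Fintype V] [DecidableEq V] (Gstar : Digraph V)
    (hG : CausalDesign.IsDAG Gstar) (kind : V → CausalDesign.InterventionKind) :
    CausalDesign.IsSubmodular (CausalDesign.averageGain Gstar kind) := by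
  intro I₁ I₂ hI x _
  simp only [CausalDesign.averageGain, ← mul_sub, ← Finset.sum_sub_distrib]
  refine mul_le_mul_of_nonneg_left (Finset.sum_le_sum fun G hG => ?_) (by positivity)
  exact CausalDesign.gain_submodular ((Set.Finite.mem_toFinset _).1 hG) kind hI x
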